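/- Let $n\ge 1$ and $k\ge 1$ be integers. A $\mathbb{Z}_n$-sequence of length $m$ is a sequence $\mathbf{x}=(x_1,\dots,x_m)$ with $x_i\in\mathbb{Z}_n=\mathbb{Z}/n\mathbb{Z}$; it is $k$-restricted if no element of $\mathbb{Z}_n$ appears more than $k$ times in it. It is an Erdős Z-sequence if $\sum_{i\in I}x_i=0$ for some $I\subseteq\{1,\dots,m\}$ with $|I|=n$, and a Davenport Z-sequence if $\sum_{i\in I}x_i=0$ for some nonempty $I\subseteq\{1,\dots,m\}$. Let $\mathsf{s}^{(k)}(\mathbb{Z}_n)$ be the least integer $m\ge 0$ such that every $k$-restricted $\mathbb{Z}_n$-sequence of length $m$ is an Erdős Z-sequence, and let $\mathsf{D}^{(k)}(\mathbb{Z}_n)$ be the least integer $m\ge 0$ such that every $k$-restricted $\mathbb{Z}_n$-sequence of length $m$ is a Davenport Z-sequence. (1) $\mathsf{s}^{(2)}(\mathbb{Z}_n)\le n+2$ for every $n\ge 1$, and $\mathsf{s}^{(2)}(\mathbb{Z}_n)=n+2$ for every $n\ge 1$ with $n\notin\{1,2,4\}$. (2) For every $k\ge 2$ and every prime $p$, $\mathsf{s}^{(k)}(\mathbb{Z}_p)\le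 p+k$. Furthermore, for every $k\ge 2$ there is an integer $p_0(k)$ such that $\mathsf{s}^{(k)}(\mathbb{Z}_p)\ge p+k$ for all primes $p\ge p_0(k)$. (3) There are absolute constants $c,C>0$ such that the following hold. For all $k\ge 2$ and $n\ge 1$, every $k$-restricted $\mathbb{Z}_n$-sequence of length $m\ge C\sqrt{nk}$ is a Davenport Z-sequence, and $\mathsf{D}^{(k)}(\mathbb{Z}_n)\le C\sqrt{nk}$. For all $2\le k\le n$, there is a $k$-restricted $\mathbb{Z}_n$-sequence of some length $m\ge c\sqrt{nk}$ that is not a Davenport Z-sequence, and $\mathsf{D}^{(k)}(\mathbb{Z}_n)\ge c\sqrt{nk}$. In other words, $\mathsf{D}^{(k)}(\mathbb{Z}_n)=\Theta(\sqrt{nk})$ uniformly for $2\le k\le n$. -/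

import Mathlib

/-- A sequence `x = (x₁, …, x_m)` over `ℤ/nℤ` is `k`-restricted if no element of `ℤ/nℤ` appears
more than `k` times in it. -/
def IsRestricted {n m : ℕ} (k : ℕ) (x : Fin m → ZMod n) : Prop :=
  ∀ a : ZMod n, (Finset.univ.filter fun i => x i = a).card ≤ k

/-- A Davenport Z-sequence: some nonempty subsequence has sum zero. -/
def IsDavenportZ {n m : ℕ} (x : Fin m → ZMod n) : Prop :=
  ∃ I : Finset (Fin m), I.Nonempty ∧ ∑ i ∈ I, x i = 0

/-- An Erdős Z-sequence over `ℤ/nℤ`: some subsequence of length exactly `n` has sum zero. -/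
def IsErdosZ {n m : ℕ} (x : Fin m → ZMod n) : Prop :=
  ∃ I : Finset (Fin m), I.card = n ∧ ∑ i ∈ I, x i = 0

/-- The least `m` such that every `k`-restricted sequence of length `m` over `ℤ/nℤ` is an
Erdős Z-sequence. -/
noncomputable def restrictedErdosConst (k n : ℕ) : ℕ :=
  sInf {m : ℕ | ∀ x : Fin m → ZMod n, IsRestricted k x → IsErdosZ x}

/-- The least `m` such that every `k`-restricted sequence of length `m` over `ℤ/nℤ` is a
Davenport Z-sequence. -/
noncomputable def restrictedDavenportConst (k n : ℕ) : ℕ :=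
  sInf {m : ℕ | ∀ x : Fin m → ZMod n, IsRestricted k x → IsDavenportZ x}

/-- A `k`-restricted sequence over `ℤ/nℤ` has length at most `n * k`. -/
theorem IsRestricted.length_le {n m k : ℕ} [NeZero n] {x : Fin m → ZMod n}
    (hx : IsRestricted k x) : m ≤ n * k := by
  have h := Finset.card_le_mul_card_image_of_maps_to (s := (Finset.univ : Finset (Fin m)))
    (t := (Finset.univ : Finset (ZMod n))) (f := x) (fun _ _ => Finset.mem_univ _) k
    (fun a _ => hx a)
  simpa [ZMod.card, mul_comm] using h

/-- For `n ≥ 1` the infimum defining `restrictedErdosConst` is a genuine minimum. -/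
theorem restrictedErdosConst_isLeast (k n : ℕ) [NeZero n] :
    IsLeast {m : ℕ | ∀ x : Fin m → ZMod n, IsRestricted k x → IsErdosZ x}
      (restrictedErdosConst k n) :=
  ⟨Nat.sInf_mem ⟨n * k + 1, fun _ hx => absurd hx.length_le (by omega)⟩,
    fun _ hm => Nat.sInf_le hm⟩

/-- For `n ≥ 1` the infimum defining `restrictedDavenportConst` is a genuine minimum. -/
theorem restrictedDavenportConst_isLeast (k n : ℕ) [NeZero n] :
    IsLeast {m : ℕ | ∀ x : Fin m → ZMod n, IsRestricted k x → IsDavenportZ x}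
      (restrictedDavenportConst k n) :=
  ⟨Nat.sInf_mem ⟨n * k + 1, fun _ hx => absurd hx.length_le (by omega)⟩,
    fun _ hm => Nat.sInf_le hm⟩

/-!
**Erdős constants.** In a sequence of length `n + k`, some `n` terms sum to zero exactly when some
`k` terms have the same sum as the whole sequence. For prime `n`, sorting a `k`-restricted sequence
and distributing its positions modulo `k` splits it into `k` nonempty sets `A₁, …, A_k` with
`∑ |Aᵢ| = n + k`, and the Cauchy–Davenport theorem gives `A₁ + ⋯ + A_k = ℤ/n`
(`IsRestricted.isErdosZ_of_prime`). For `k = 2` and arbitrary `n` the pigeonhole principle replaces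
Cauchy–Davenport (`IsRestricted.isErdosZ_of_two`). For the lower bounds, the terms `⌊i / k⌋` with
`i < n + k - 1`, the last few raised by one to make the total `-1`, are so small that no `k - 1` of
them sum to `-1` (`le_restrictedErdosConst`).

**Davenport constants.** The lower bound comes from the sequence `1 + ⌊i / k⌋`, whose total stays
below `n` (`exists_isRestricted_not_isDavenportZ`). The upper bound holds in every finite abelian
group `G` (`card_sq_le_of_zeroSumFree`). By induction on `|G|`, a long zero-sum free sequence may
be assumed not to concentrate on a proper subgroup, so that any three quarters of its `m` terms
generate `G`. Let `B` be the set of subset sums of the terms used so far, with `|B| ≤ |G| / 2`.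
The function `y ↦ |(y + B) \ B|` is subadditive and is small for few `y` only, while iterated
sumsets of a generating set grow linearly; hence some unused term `x` has
`|(x + B) \ B| ≥ c min(m / k, |B|)` (`exists_mem_min_le_card_vadd_sdiff`). Adding such terms one by
one, `m / 10` of them give `c' m² / k` subset sums. If `m² > C k |G|`, two disjoint sets of terms
thus have more than `|G| / 2` subset sums each, so every element of `G` is a sum of one from each;
representing the negative of an unused term produces a zero sum.
-/

section
open Finset
open scoped Pointwise

/-! ### Growth of subset sums -/

/-- Iterated sumsets of a symmetric generating set grow linearly until they fill the group: as
long as `X + A ≠ X + 2A`, a point `y` of the difference gives a translate `y - A` of `A` which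
avoids `X` and lies in `X + 3A`. -/
theorem card_le_or_mul_card_le_card_nsmul {G : Type*} [AddCommGroup G] [Fintype G] [DecidableEq G]
    {A : Finset G} (h0 : (0 : G) ∈ A) (hneg : ∀ a ∈ A, -a ∈ A)
    (hgen : AddSubgroup.closure (A : Set G) = ⊤) (j : ℕ) :
    Fintype.card G ≤ ((3 * j) • A).card ∨ j * A.card ≤ ((3 * j) • A).card := by
  induction j with
  | zero => right; simp
  | succ j ih =>
    set X := (3 * j) • A with hX
    have hX3 : (3 * (j + 1)) • A = X + A + A + A := by
      rw [hX, mul_add, mul_one, add_nsmul]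
      simp only [succ_nsmul, zero_nsmul, zero_add, add_assoc]
    have hsub : ∀ Y : Finset G, Y ⊆ Y + A := fun Y => subset_add_left Y h0
    rw [hX3]
    by_cases hst : X + A + A ⊆ X + A
    · left
      have h0X : (0 : G) ∈ X + A := by
        have h1 : (0 : G) ∈ X := by
          have := nsmul_mem_nsmul (n := 3 * j) h0
          simpa using this
        exact hsub X h1
      have hall : ∀ g : G, g ∈ X + A := by
        intro g
        have hg : g ∈ AddSubgroup.closure (A : Set G) := by rw [hgen]; trivial
        induction hg using AddSubgroup.closure_induction_right with
        | zero => exact h0X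
        | add_right y z _ hz ih => exact hst (add_mem_add ih hz)
        | add_neg_cancel y z _ hz ih => exact hst (add_mem_add ih (hneg _ hz))
      have : X + A = univ := by ext g; simp [hall g]
      rw [this, ← card_univ]
      exact card_le_card ((hsub _).trans (hsub _))
    · rw [not_subset] at hst
      obtain ⟨y, hy, hyn⟩ := hst
      rcases ih with ih | ih
      · left
        exact ih.trans (card_le_card ((hsub X).trans ((hsub _).trans (hsub _))))
      · right
        have hdisj : Disjoint X (A.image fun a => y - a) := by
          rw [disjoint_left]
          rintro z hz hz'
          obtain ⟨a, ha, rfl⟩ := mem_image.1 hz'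
          exact hyn (by simpa using add_mem_add hz ha)
        have hcard : (A.image fun a => y - a).card = A.card :=
          card_image_of_injective _ fun a b h => by simpa using h
        have hunion : X ∪ (A.image fun a => y - a) ⊆ X + A + A + A := by
          apply union_subset ((hsub X).trans ((hsub _).trans (hsub _)))
          intro z hz
          obtain ⟨a, ha, rfl⟩ := mem_image.1 hz
          rw [sub_eq_add_neg]
          exact add_mem_add hy (hneg a ha)
        have := card_le_card hunion
        rw [card_union_of_disjoint hdisj, hcard] at this
        linarith [add_mul j 1 A.card]

theorem card_vadd_sdiff_add {G : Type*} [AddCommGroup G] [DecidableEq G] (B : Finset G) (x y : G) :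
    (((x + y) +ᵥ B) \ B).card ≤ ((x +ᵥ B) \ B).card + ((y +ᵥ B) \ B).card := by
  have h : ((x + y) +ᵥ B) \ B ⊆ ((x +ᵥ B) \ B) ∪ (x +ᵥ ((y +ᵥ B) \ B)) := by
    intro z hz
    rw [mem_sdiff] at hz
    rw [vadd_finset_sdiff, ← add_vadd, mem_union, mem_sdiff, mem_sdiff]
    tauto
  calc _ ≤ _ := card_le_card h
    _ ≤ _ := card_union_le _ _
    _ = _ := by rw [card_vadd_finset]

theorem card_neg_vadd_sdiff {G : Type*} [AddCommGroup G] [DecidableEq G] (B : Finset G) (x : G) :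
    ((-x +ᵥ B) \ B).card = ((x +ᵥ B) \ B).card := by
  have h : (x +ᵥ ((-x +ᵥ B) \ B)).card = (B \ (x +ᵥ B)).card := by
    rw [vadd_finset_sdiff, ← add_vadd]; simp
  rw [card_vadd_finset] at h
  rw [h]
  have h1 := card_sdiff_add_card_inter B (x +ᵥ B)
  have h2 := card_sdiff_add_card_inter (x +ᵥ B) B
  rw [inter_comm, card_vadd_finset] at h2
  omega

/-- Only few translates of `B` almost coincide with `B`, because the overlaps `|(y + B) ∩ B|`
sum to `|B|²`. -/
theorem card_filter_small_sdiff {G : Type*} [AddCommGroup G] [Fintype G] [DecidableEq G]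
    {B : Finset G} (hB : B.Nonempty) :
    3 * (univ.filter fun y : G => 4 * ((y +ᵥ B) \ B).card ≤ B.card).card ≤ 4 * B.card := by
  set Y := univ.filter fun y : G => 4 * ((y +ᵥ B) \ B).card ≤ B.card with hY
  have h1 : ∀ y ∈ Y, 3 * B.card ≤ 4 * ((y +ᵥ B) ∩ B).card := by
    intro y hy
    have h2 := card_sdiff_add_card_inter (y +ᵥ B) B
    rw [card_vadd_finset] at h2
    have := (mem_filter.1 hy).2
    omega
  have h2 : ∑ y ∈ Y, ((y +ᵥ B) ∩ B).card ≤ B.card * B.card := by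
    have e := sum_card_bipartiteAbove_eq_sum_card_bipartiteBelow (s := Y) (t := B)
      (fun (y b : G) => b ∈ y +ᵥ B)
    have e1 : ∀ y : G, (bipartiteAbove (fun (y b : G) => b ∈ y +ᵥ B) B y) = (y +ᵥ B) ∩ B := by
      intro y; ext b; simp [bipartiteAbove, and_comm]
    simp only [e1] at e
    rw [e, ← smul_eq_mul, ← sum_const]
    refine sum_le_sum fun b _ => ?_
    refine card_le_card_of_injOn (fun y => b - y) ?_ ?_
    · intro y hy
      have hy : b ∈ y +ᵥ B := (mem_filter.1 hy).2
      rw [mem_vadd_finset] at hy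
      obtain ⟨c, hc, rfl⟩ := hy
      simpa using hc
    · intro y _ z _ h
      simpa using h
  have h3 : Y.card * (3 * B.card) ≤ 4 * (B.card * B.card) := by
    calc Y.card * (3 * B.card) = ∑ _y ∈ Y, 3 * B.card := by simp
      _ ≤ ∑ y ∈ Y, 4 * ((y +ᵥ B) ∩ B).card := sum_le_sum h1
      _ = 4 * ∑ y ∈ Y, ((y +ᵥ B) ∩ B).card := by rw [mul_sum]
      _ ≤ _ := Nat.mul_le_mul_left 4 h2
  have hpos := hB.card_pos
  nlinarith

/-- If `S` generates `G` and `B` is at most half of `G`, then some translation by an element of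
`S` moves a number of points out of `B` that is comparable to `min |S| |B|`. Otherwise the many
elements of an iterated sumset of `S ∪ {0} ∪ -S` would all nearly stabilize `B`. -/
theorem exists_mem_min_le_card_vadd_sdiff {G : Type*} [AddCommGroup G] [Fintype G] [DecidableEq G]
    {S B : Finset G} (hgen : AddSubgroup.closure (S : Set G) = ⊤) (hS : S.Nonempty)
    (hB : B.Nonempty) (hBG : 2 * B.card ≤ Fintype.card G) :
    ∃ x ∈ S, min S.card B.card ≤ 32 * ((x +ᵥ B) \ B).card := by
  obtain ⟨x, hx, hmax⟩ := S.exists_max_image (fun x => ((x +ᵥ B) \ B).card) hS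
  refine ⟨x, hx, ?_⟩
  set t := ((x +ᵥ B) \ B).card with ht
  set A := insert 0 (S ∪ -S) with hA
  have hSA : S ⊆ A := subset_union_left.trans (subset_insert _ _)
  have hr := hS.card_pos
  have hb := hB.card_pos
  have hAt : ∀ a ∈ A, ((a +ᵥ B) \ B).card ≤ t := by
    intro a ha
    rw [hA, mem_insert, mem_union, mem_neg'] at ha
    rcases ha with rfl | ha | ha
    · simp
    · exact hmax a ha
    · rw [← card_neg_vadd_sdiff]; exact hmax _ ha
  have hiA : ∀ i : ℕ, ∀ a ∈ i • A, ((a +ᵥ B) \ B).card ≤ i * t := by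
    intro i
    induction i with
    | zero => intro a ha; simp at ha; simp [ha]
    | succ i ih =>
      intro a ha
      rw [succ_nsmul, mem_add] at ha
      obtain ⟨c, hc, d, hd, rfl⟩ := ha
      have := card_vadd_sdiff_add B c d
      have := ih c hc
      have := hAt d hd
      rw [add_mul, one_mul]; omega
  -- The multiple `j` is chosen so that `j |S|` just exceeds `4 |B| / 3`, which bounds the number of elements
  -- that can move at most a quarter of `B` out of `B`.
  have hgrow := card_le_or_mul_card_le_card_nsmul (A := A) (mem_insert_self _ _)
    (by
      intro a ha
      simp only [hA, mem_insert, mem_union, mem_neg', neg_eq_zero, neg_neg] at ha ⊢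
      tauto)
    (by
      rw [eq_top_iff, ← hgen]
      exact AddSubgroup.closure_mono (by exact_mod_cast hSA))
    (4 * B.card / (3 * S.card) + 1)
  set j := 4 * B.card / (3 * S.card) + 1 with hj
  have hj1 : 4 * B.card < 3 * S.card * j := Nat.lt_mul_div_succ _ (by omega)
  have hj2 : 3 * S.card * j ≤ 4 * B.card + 3 * S.card := by
    rw [hj, mul_add, mul_one]
    exact Nat.add_le_add_right (Nat.mul_div_le _ _) _
  have hbig : 4 * B.card < 3 * ((3 * j) • A).card := by
    rcases hgrow with h | h
    · omega
    · have : j * S.card ≤ j * A.card := Nat.mul_le_mul_left _ (card_le_card hSA)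
      nlinarith
  have hsm := card_filter_small_sdiff hB
  obtain ⟨y, hy, hyn⟩ : ∃ y ∈ (3 * j) • A,
      y ∉ univ.filter fun y : G => 4 * ((y +ᵥ B) \ B).card ≤ B.card := by
    by_contra! hcon
    have := card_le_card (show (3 * j) • A ⊆ _ from hcon)
    omega
  have hy1 := hiA _ y hy
  simp only [mem_filter, mem_univ, true_and, not_le] at hyn
  have hlt : B.card < 12 * j * t := by nlinarith
  -- Some `y` in the `3j`-fold sumset moves more than `|B| / 4` points out of `B`, but at most
  -- `3jt` by subadditivity.
  have hmul : B.card * S.card < 4 * t * (4 * B.card + 3 * S.card) := by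
    have h1 : B.card * (3 * S.card) < 12 * j * t * (3 * S.card) :=
      Nat.mul_lt_mul_of_pos_right hlt (by omega)
    have h2 : 12 * t * (3 * S.card * j) ≤ 12 * t * (4 * B.card + 3 * S.card) :=
      Nat.mul_le_mul_left _ hj2
    nlinarith
  rcases le_total S.card B.card with h | h
  · rw [min_eq_left h]; nlinarith
  · rw [min_eq_right h]; nlinarith

/-- The set of all sums `∑ i ∈ J, x i` with `J ⊆ P`, the empty sum included. -/
def subsetSums {ι G : Type*} [AddCommMonoid G] [DecidableEq G] (x : ι → G) (P : Finset ι) :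
    Finset G :=
  P.powerset.image fun J => ∑ i ∈ J, x i

theorem mem_subsetSums {ι G : Type*} [AddCommMonoid G] [DecidableEq G] {x : ι → G}
    {P : Finset ι} {g : G} : g ∈ subsetSums x P ↔ ∃ J ⊆ P, ∑ i ∈ J, x i = g := by
  simp [subsetSums]

theorem subsetSums_nonempty {ι G : Type*} [AddCommMonoid G] [DecidableEq G] (x : ι → G)
    (P : Finset ι) : (subsetSums x P).Nonempty :=
  ⟨0, mem_subsetSums.2 ⟨∅, empty_subset _, sum_empty⟩⟩

theorem card_subsetSums_insert {ι G : Type*} [AddCommGroup G] [DecidableEq G] [DecidableEq ι]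
    (x : ι → G) {P : Finset ι} {i : ι} (hi : i ∉ P) :
    (subsetSums x P).card + ((x i +ᵥ subsetSums x P) \ subsetSums x P).card ≤
      (subsetSums x (insert i P)).card := by
  rw [← card_union_of_disjoint disjoint_sdiff]
  apply card_le_card
  apply union_subset
  · intro g hg
    obtain ⟨J, hJ, rfl⟩ := mem_subsetSums.1 hg
    exact mem_subsetSums.2 ⟨J, hJ.trans (subset_insert _ _), rfl⟩
  · intro g hg
    obtain ⟨h, hh, rfl⟩ := mem_vadd_finset.1 (mem_sdiff.1 hg).1
    obtain ⟨J, hJ, rfl⟩ := mem_subsetSums.1 hh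
    refine mem_subsetSums.2 ⟨insert i J, insert_subset_insert _ hJ, ?_⟩
    rw [sum_insert fun h => hi (hJ h), vadd_eq_add]

/-- Adding indices one at a time: if every step enlarges the subset sums by at least `δ / D`
while they occupy at most half of `G`, then `q` steps enlarge them by `q * δ / D`, or more than
half of `G` is reached. -/
theorem exists_subset_card_subsetSums {ι G : Type*} [AddCommGroup G] [Fintype G] [DecidableEq G]
    [DecidableEq ι] (x : ι → G) {R P₀ : Finset ι} (hP₀ : P₀ ⊆ R) (D δ : ℕ) (q : ℕ)
    (hstep : ∀ P ⊆ R, P₀ ⊆ P → P.card ≤ P₀.card + q →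
      2 * (subsetSums x P).card ≤ Fintype.card G → ∃ i ∈ R \ P,
        δ ≤ D * ((x i +ᵥ subsetSums x P) \ subsetSums x P).card) :
    ∃ P ⊆ R, P₀ ⊆ P ∧ P.card ≤ P₀.card + q ∧
      (Fintype.card G < 2 * (subsetSums x P).card ∨
        D * (subsetSums x P₀).card + q * δ ≤ D * (subsetSums x P).card) := by
  induction q with
  | zero => exact ⟨P₀, hP₀, subset_rfl, le_rfl, Or.inr (by simp)⟩
  | succ q ih =>
    obtain ⟨P, hPR, hP, hPc, h⟩ := ih fun P h1 h2 h3 => hstep P h1 h2 (by omega)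
    by_cases hbig : Fintype.card G < 2 * (subsetSums x P).card
    · exact ⟨P, hPR, hP, by omega, Or.inl hbig⟩
    obtain ⟨i, hi, hδ⟩ := hstep P hPR hP (by omega) (by omega)
    rw [mem_sdiff] at hi
    refine ⟨insert i P, insert_subset hi.1 hPR, hP.trans (subset_insert _ _), ?_, Or.inr ?_⟩
    · rw [card_insert_of_notMem hi.2]; omega
    · have h1 := Nat.mul_le_mul_left D (card_subsetSums_insert x hi.2)
      rw [mul_add] at h1
      have h2 := h.resolve_left hbig
      rw [add_mul, one_mul]; omega

/-- If any three quarters of the indices in `I` generate `G`, then after discarding few indices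
one still finds few indices whose subset sums fill more than half of `G`. -/
theorem exists_subset_half_lt_subsetSums {ι G : Type*} [AddCommGroup G] [Fintype G]
    [DecidableEq G] [DecidableEq ι] {x : ι → G} {I : Finset ι} {k : ℕ}
    (hk : ∀ a : G, (I.filter fun i => x i = a).card ≤ k)
    (hgen : ∀ R ⊆ I, 3 * I.card ≤ 4 * R.card → AddSubgroup.closure (x '' R) = ⊤)
    (hI : 25600 * k * Fintype.card G < I.card ^ 2) (hI40 : 40 ≤ I.card)
    {Q : Finset ι} (hQ : Q ⊆ I) (hQc : Q.card ≤ 2 * (I.card / 20)) :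
    ∃ P ⊆ I \ Q, P.card ≤ 2 * (I.card / 20) ∧ Fintype.card G < 2 * (subsetSums x P).card := by
  set u := I.card / 20 with hu
  have hstep : ∀ P ⊆ I \ Q, P.card ≤ 2 * u → 2 * (subsetSums x P).card ≤ Fintype.card G →
      ∃ i ∈ (I \ Q) \ P, ∃ r, 3 * I.card ≤ 4 * (k * r) ∧
        min r (subsetSums x P).card ≤ 32 * ((x i +ᵥ subsetSums x P) \ subsetSums x P).card := by
    intro P hP hPc hPG
    set R := (I \ Q) \ P with hR
    have hRI : R ⊆ I := sdiff_subset.trans sdiff_subset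
    have hRc : 3 * I.card ≤ 4 * R.card := by
      have h1 := card_sdiff_add_card_eq_card hP
      have h2 := card_sdiff_add_card_eq_card hQ
      rw [← hR] at h1
      omega
    have hRn : R.Nonempty := card_pos.1 (by omega)
    obtain ⟨y, hy, hmin⟩ := exists_mem_min_le_card_vadd_sdiff (S := R.image x)
      (by rw [coe_image]; exact hgen R hRI hRc) (hRn.image x) (subsetSums_nonempty x P) hPG
    obtain ⟨i, hi, rfl⟩ := mem_image.1 hy
    refine ⟨i, hi, _, ?_, hmin⟩
    have := card_le_mul_card_image R k fun a _ =>
      (card_le_card (filter_subset_filter _ hRI)).trans (hk a)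
    omega
  -- The guaranteed growth is capped by the size of the subset sums, so a first run of `u` steps,
  -- each adding at least one sum, makes that cap harmless in the second run.
  obtain ⟨P₁, hP₁, -, hP₁c, h₁⟩ := exists_subset_card_subsetSums x (empty_subset (I \ Q)) 1 1 u
    (by
      intro P hP _ hPc hPG
      obtain ⟨i, hi, r, hr, hmin⟩ := hstep P hP (by rw [card_empty] at hPc; omega) hPG
      refine ⟨i, hi, ?_⟩
      have h0 := (subsetSums_nonempty x P).card_pos
      have h1 : 0 < r := by
        rcases Nat.eq_zero_or_pos r with h | h
        · subst h; simp only [mul_zero] at hr; omega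
        · exact h
      have := lt_min h1 h0
      omega)
  rw [card_empty, zero_add] at hP₁c
  rcases h₁ with h₁ | h₁
  · exact ⟨P₁, hP₁, by omega, h₁⟩
  obtain ⟨P, hP, -, hPc, h⟩ := exists_subset_card_subsetSums x hP₁ (32 * k) u u
    (by
      intro P hP hPP hPc hPG
      obtain ⟨i, hi, r, hr, hmin⟩ := hstep P hP (by omega) hPG
      refine ⟨i, hi, ?_⟩
      have hmono : (subsetSums x P₁).card ≤ (subsetSums x P).card :=
        card_le_card (image_subset_image (powerset_mono.2 hPP))
      have h2 : u ≤ k * min r (subsetSums x P).card := by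
        rcases Nat.eq_zero_or_pos k with h | h
        · subst h; simp only [mul_zero, zero_mul] at hr; omega
        rcases min_choice r (subsetSums x P).card with h' | h' <;> rw [h']
        · have : 20 * u ≤ I.card := Nat.mul_div_le _ _
          linarith
        · exact le_trans (by omega) (Nat.le_mul_of_pos_left _ h)
      calc u ≤ k * min r (subsetSums x P).card := h2
        _ ≤ k * (32 * ((x i +ᵥ subsetSums x P) \ subsetSums x P).card) :=
          Nat.mul_le_mul_left k hmin
        _ = _ := by ring)
  refine ⟨P, hP, by omega, h.elim id fun h => ?_⟩
  by_contra! hcon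
  have h1 : 16 * k * (2 * (subsetSums x P).card) ≤ 16 * k * Fintype.card G :=
    Nat.mul_le_mul_left _ hcon
  have h3 : u * u + 32 * k ≤ 16 * k * Fintype.card G := by
    have := (subsetSums_nonempty x P₁).card_pos
    have : 32 * k * 1 ≤ 32 * k * (subsetSums x P₁).card := Nat.mul_le_mul_left _ this
    linarith
  have h5 : I.card ≤ 40 * u := by omega
  nlinarith

/-! ### Zero-sum free families in finite abelian groups -/

/-- The bound for a zero-sum free family any three quarters of which generate `G`. Two index sets
whose subset sums both fill more than half of `G` represent every element of `G`; applied to the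
negative of one further term, this gives a zero sum. -/
theorem card_sq_le_of_generating {ι G : Type*} [AddCommGroup G] [Fintype G] [DecidableEq G]
    [DecidableEq ι] {x : ι → G} {I : Finset ι} {k : ℕ}
    (hk : ∀ a : G, (I.filter fun i => x i = a).card ≤ k)
    (hgen : ∀ R ⊆ I, 3 * I.card ≤ 4 * R.card → AddSubgroup.closure (x '' R) = ⊤)
    (hzero : ∀ J ⊆ I, J.Nonempty → ∑ i ∈ J, x i ≠ 0) :
    I.card ^ 2 ≤ 25600 * k * Fintype.card G := by
  by_contra! hI
  have hI40 : 40 ≤ I.card := by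
    have hI0 : I.Nonempty := by
      rw [nonempty_iff_ne_empty]; rintro rfl; simp at hI
    obtain ⟨i, hi⟩ := hI0
    have hk1 : 1 ≤ k :=
      (card_pos.2 ⟨i, mem_filter.2 ⟨hi, rfl⟩⟩ : 0 < (I.filter fun i' => x i' = x i).card).trans_le
        (hk (x i))
    have hG : 1 ≤ Fintype.card G := Fintype.card_pos
    have := Nat.mul_le_mul hk1 hG
    nlinarith
  obtain ⟨P, hP, hPc, hPG⟩ := exists_subset_half_lt_subsetSums hk hgen hI hI40 (empty_subset I)
    (by simp)
  rw [sdiff_empty] at hP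
  obtain ⟨Q, hQ, hQc, hQG⟩ := exists_subset_half_lt_subsetSums hk hgen hI hI40 hP hPc
  obtain ⟨i, hi⟩ : (I \ (P ∪ Q)).Nonempty := by
    rw [← card_pos]
    have h1 := le_card_sdiff (P ∪ Q) I
    have h2 := card_union_le P Q
    omega
  rw [mem_sdiff, mem_union, not_or] at hi
  obtain ⟨hiI, hiP, hiQ⟩ := hi
  have hmeet : ¬ Disjoint (subsetSums x P) ((subsetSums x Q).image fun g => -x i - g) := by
    intro hd
    have h1 := card_le_univ (subsetSums x P ∪ (subsetSums x Q).image fun g => -x i - g)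
    rw [card_union_of_disjoint hd, card_image_of_injective _ fun a b h => by simpa using h] at h1
    omega
  obtain ⟨g, hg, hg'⟩ := not_disjoint_iff.1 hmeet
  obtain ⟨h, hh, rfl⟩ := mem_image.1 hg'
  obtain ⟨J, hJ, hJs⟩ := mem_subsetSums.1 hg
  obtain ⟨K, hK, rfl⟩ := mem_subsetSums.1 hh
  have hJK : Disjoint J K := disjoint_of_subset_left hJ
    (disjoint_of_subset_right hK (disjoint_sdiff.mono_right hQ))
  have hi' : i ∉ J ∪ K := by
    rw [mem_union, not_or]; exact ⟨fun h => hiP (hJ h), fun h => hiQ (hK h)⟩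
  refine hzero (insert i (J ∪ K)) ?_ (insert_nonempty _ _) ?_
  · exact insert_subset hiI (union_subset (hJ.trans hP) ((hK.trans hQ).trans sdiff_subset))
  · rw [sum_insert hi', sum_union hJK, hJs]; abel

/-- A zero-sum free family in a finite abelian group `G`, in which every value is taken at most
`k` times, has length `O(√(k |G|))`. If too many of the terms lie in a proper subgroup, which has
at most half the order of `G`, the bound for that subgroup suffices; otherwise any three quarters
of the terms generate `G`. -/
theorem card_sq_le_of_zeroSumFree {ι : Type*} {k : ℕ} (N : ℕ) :
    ∀ {G : Type*} [AddCommGroup G] [Fintype G] [DecidableEq G] {x : ι → G} {I : Finset ι},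
      Fintype.card G = N → (∀ a : G, (I.filter fun i => x i = a).card ≤ k) →
      (∀ J ⊆ I, J.Nonempty → ∑ i ∈ J, x i ≠ 0) → I.card ^ 2 ≤ 25600 * k * N := by
  classical
  induction N using Nat.strong_induction_on with
  | _ N ih =>
  intro G _ _ _ x I hN hk hzero
  rcases I.eq_empty_or_nonempty with rfl | hI
  · simp
  by_cases hsub : ∃ K : AddSubgroup G, K ≠ ⊤ ∧ I.card ^ 2 < 2 * (I.filter (x · ∈ K)).card ^ 2
  · obtain ⟨K, hK, hIK⟩ := hsub
    have hcard : 2 * Fintype.card K ≤ N := by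
      have h1 := K.card_mul_index
      have h2 : K.index ≠ 1 := by rwa [Ne, AddSubgroup.index_eq_one]
      have h3 : K.index ≠ 0 := AddSubgroup.index_ne_zero_of_finite
      rw [Nat.card_eq_fintype_card, Nat.card_eq_fintype_card, hN] at h1
      have h4 : 2 ≤ K.index := by omega
      nlinarith
    have hpos : 0 < Fintype.card K := Fintype.card_pos
    set y : ι → K := fun i => if h : x i ∈ K then ⟨x i, h⟩ else 0 with hy
    have hyx : ∀ i ∈ I.filter (x · ∈ K), (y i : G) = x i := by
      intro i hi
      simp [hy, (mem_filter.1 hi).2]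
    have := ih (Fintype.card K) (by omega) (x := y) (I := I.filter (x · ∈ K)) rfl
      (by
        intro a
        refine le_trans (card_le_card ?_) (hk a)
        intro i hi
        rw [mem_filter] at hi
        rw [mem_filter, ← hyx i hi.1, hi.2]
        exact ⟨(mem_filter.1 hi.1).1, rfl⟩)
      (by
        intro J hJ hJn h0
        refine hzero J (hJ.trans (filter_subset _ _)) hJn ?_
        rw [← sum_congr rfl fun i hi => hyx i (hJ hi), ← AddSubgroup.val_finsetSum, h0]
        rfl)
    have h2 : 25600 * k * (2 * Fintype.card K) ≤ 25600 * k * N := Nat.mul_le_mul_left _ hcard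
    linarith
  · push Not at hsub
    rw [← hN]
    -- A proper subgroup containing `R` would contain too many terms, as `2 (3 / 4)² > 1`.
    refine card_sq_le_of_generating hk (fun R hR hRc => ?_) hzero
    by_contra hne
    have h1 := hsub _ hne
    have h2 : R.card ≤ (I.filter (x · ∈ AddSubgroup.closure (x '' R))).card :=
      card_le_card fun i hi => mem_filter.2
        ⟨hR hi, AddSubgroup.subset_closure (Set.mem_image_of_mem x hi)⟩
    have := hI.card_pos
    nlinarith

/-! ### Basic facts on restricted sequences -/

theorem IsRestricted.comp {n m l k : ℕ} {x : Fin m → ZMod n} (hx : IsRestricted k x)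
    {f : Fin l → Fin m} (hf : Function.Injective f) : IsRestricted k (x ∘ f) := fun a =>
  (card_le_card_of_injOn f (fun i hi => by simpa using hi) hf.injOn).trans (hx a)

theorem lt_restrictedDavenportConst {n m k : ℕ} [NeZero n] {x : Fin m → ZMod n}
    (hx : IsRestricted k x) (hD : ¬ IsDavenportZ x) : m < restrictedDavenportConst k n := by
  by_contra! hle
  obtain ⟨I, hI, hs⟩ := (restrictedDavenportConst_isLeast k n).1 _
    (hx.comp (Fin.castLE_injective hle))
  exact hD ⟨I.map (Fin.castLEEmb hle), hI.map, by simpa [sum_map] using hs⟩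

theorem lt_restrictedErdosConst {n m k : ℕ} [NeZero n] {x : Fin m → ZMod n}
    (hx : IsRestricted k x) (hE : ¬ IsErdosZ x) : m < restrictedErdosConst k n := by
  by_contra! hle
  obtain ⟨I, hI, hs⟩ := (restrictedErdosConst_isLeast k n).1 _
    (hx.comp (Fin.castLE_injective hle))
  exact hE ⟨I.map (Fin.castLEEmb hle), by simpa using hI, by simpa [sum_map] using hs⟩

/-- A sequence of length `n + k` is an Erdős Z-sequence as soon as `k` of its terms have the same
sum as the whole sequence: the other `n` terms then sum to zero. -/
theorem isErdosZ_of_sum_eq {n k : ℕ} {x : Fin (n + k) → ZMod n} {J : Finset (Fin (n + k))}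
    (hJ : J.card = k) (hs : ∑ i ∈ J, x i = ∑ i, x i) : IsErdosZ x := by
  refine ⟨Jᶜ, by rw [card_compl, hJ, Fintype.card_fin]; omega, ?_⟩
  have := sum_add_sum_compl J x
  rw [hs] at this
  simpa using this

/-! ### Upper bounds for the restricted Erdős constants -/

/-- If `A` is the set of values and `A₂` the set of values taken twice, then
`|A| + |A₂| = n + 2 > n`, so any element is a sum `a + b` with `a ∈ A` and `b ∈ A₂`. -/
theorem IsRestricted.isErdosZ_of_two {n : ℕ} [NeZero n] {x : Fin (n + 2) → ZMod n}
    (hx : IsRestricted 2 x) : IsErdosZ x := by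
  set A := univ.filter fun a : ZMod n => 1 ≤ (univ.filter fun i => x i = a).card with hA
  set A₂ := univ.filter fun a : ZMod n => 2 ≤ (univ.filter fun i => x i = a).card with hA₂
  have hsum : n + 2 ≤ A.card + A₂.card := by
    have h1 : (univ : Finset (Fin (n + 2))).card =
        ∑ a : ZMod n, (univ.filter fun i => x i = a).card :=
      card_eq_sum_card_fiberwise fun _ _ => mem_coe.2 (mem_univ _)
    rw [card_univ, Fintype.card_fin] at h1
    rw [h1, hA, hA₂, card_filter, card_filter, ← sum_add_distrib]
    refine sum_le_sum fun a _ => ?_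
    have := hx a
    split_ifs <;> omega
  have hmeet : ¬ Disjoint A (A₂.image fun b => ∑ i, x i - b) := by
    intro hd
    have h1 := card_le_univ (A ∪ A₂.image fun b => ∑ i, x i - b)
    rw [card_union_of_disjoint hd, card_image_of_injective _ fun a b h => by simpa using h,
      ZMod.card] at h1
    omega
  obtain ⟨a, ha, ha'⟩ := not_disjoint_iff.1 hmeet
  obtain ⟨b, hb, hab⟩ := mem_image.1 ha'
  obtain ⟨i, hi⟩ := card_pos.1 (mem_filter.1 ha).2
  obtain ⟨j, hj, hji⟩ := exists_mem_ne (mem_filter.1 hb).2 i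
  refine isErdosZ_of_sum_eq (J := {i, j}) (card_pair hji.symm) ?_
  rw [sum_pair hji.symm, (mem_filter.1 hi).2, (mem_filter.1 hj).2, ← hab]
  abel

/-- The Cauchy–Davenport theorem for several summands. -/
theorem ZMod.le_card_sum_of_sum_card {ι : Type*} {p : ℕ} (hp : p.Prime) (s : Finset ι)
    {A : ι → Finset (ZMod p)} (hA : ∀ r ∈ s, (A r).Nonempty) :
    p ≤ (∑ r ∈ s, A r).card ∨ ∑ r ∈ s, (A r).card + 1 ≤ (∑ r ∈ s, A r).card + s.card := by
  classical
  have : Fact p.Prime := ⟨hp⟩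
  suffices h : (∑ r ∈ s, A r).Nonempty ∧ (p ≤ (∑ r ∈ s, A r).card ∨
      ∑ r ∈ s, (A r).card + 1 ≤ (∑ r ∈ s, A r).card + s.card) from h.2
  induction s using Finset.induction_on with
  | empty => simp
  | insert r s hr ih =>
    obtain ⟨hne, ih⟩ := ih fun i hi => hA i (mem_insert_of_mem hi)
    have hAr := hA r (mem_insert_self _ _)
    rw [sum_insert hr, sum_insert hr, card_insert_of_notMem hr]
    refine ⟨hAr.add hne, ?_⟩
    have h := ZMod.cauchy_davenport hp hAr hne
    have := hAr.card_pos
    have := hne.card_pos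
    rcases min_choice p ((A r).card + (∑ r ∈ s, A r).card - 1) with h' | h' <;> rw [h'] at h <;>
      omega

/-- A `k`-restricted sequence can be split into `k` classes of distinct terms: sort it and
distribute the positions according to their residues modulo `k`. -/
theorem IsRestricted.exists_coloring {n m k : ℕ} [NeZero n] (hk : 0 < k) (hm : k ≤ m)
    {x : Fin m → ZMod n} (hx : IsRestricted k x) :
    ∃ c : Fin m → ℕ, (∀ i, c i < k) ∧ (∀ r < k, ∃ i, c i = r) ∧
      ∀ i j, c i = c j → x i = x j → i = j := by
  set τ := Tuple.sort fun i => (x i).val with hτ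
  have hmono : Monotone fun i => (x (τ i)).val := Tuple.monotone_sort fun i => (x i).val
  refine ⟨fun i => (τ.symm i : ℕ) % k, fun i => Nat.mod_lt _ hk, fun r hr => ?_, ?_⟩
  · exact ⟨τ ⟨r, by omega⟩, by simp [Nat.mod_eq_of_lt hr]⟩
  -- Equal terms at sorted positions `a < b` with `a ≡ b` modulo `k` have `k + 1` equal terms
  -- between them.
  have key : ∀ a b : Fin m, (a : ℕ) % k = b % k → x (τ a) = x (τ b) → ¬ a < b := by
    intro a b hab hxab hlt
    have hlt' : (a : ℕ) < b := hlt
    have hge : (a : ℕ) + k ≤ b := by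
      have h1 : k ∣ (b : ℕ) - a := (Nat.modEq_iff_dvd' hlt'.le).1 hab
      have := Nat.le_of_dvd (by omega) h1
      omega
    have hcard : (Icc a b).card ≤ k := by
      refine (card_le_card_of_injOn τ ?_ τ.injective.injOn).trans (hx (x (τ a)))
      intro i hi
      have hi := mem_Icc.1 (mem_coe.1 hi)
      have h1 := hmono hi.1
      have h2 := hmono hi.2
      simp only [← hxab] at h1 h2
      simpa using ZMod.val_injective n (le_antisymm h2 h1)
    rw [Fin.card_Icc] at hcard
    omega
  intro i j hc hxij
  have h1 := key (τ.symm i) (τ.symm j) hc (by simpa using hxij)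
  have h2 := key (τ.symm j) (τ.symm i) hc.symm (by simpa using hxij.symm)
  exact τ.symm.injective (le_antisymm (not_lt.1 h2) (not_lt.1 h1))

theorem IsRestricted.isErdosZ_of_prime {p k : ℕ} (hp : p.Prime) (hk : 0 < k)
    {x : Fin (p + k) → ZMod p} (hx : IsRestricted k x) : IsErdosZ x := by
  have : Fact p.Prime := ⟨hp⟩
  obtain ⟨c, hck, hsurj, hinj⟩ := hx.exists_coloring hk (Nat.le_add_left k p)
  set A : ℕ → Finset (ZMod p) := fun r => (univ.filter fun i => c i = r).image x with hA
  have hAcard : ∑ r ∈ range k, (A r).card = p + k := by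
    have h1 : (univ : Finset (Fin (p + k))).card =
        ∑ r ∈ range k, (univ.filter fun i => c i = r).card :=
      card_eq_sum_card_fiberwise fun i _ => by simpa using hck i
    rw [card_univ, Fintype.card_fin] at h1
    rw [h1]
    refine sum_congr rfl fun r _ => card_image_of_injOn fun i hi j hj h => ?_
    simp only [coe_filter, mem_univ, true_and, Set.mem_ofPred_eq] at hi hj
    exact hinj i j (hi.trans hj.symm) h
  have hfull : ∑ r ∈ range k, A r = univ := by
    rw [← card_eq_iff_eq_univ, ZMod.card]
    refine le_antisymm ((card_le_univ _).trans_eq (ZMod.card p)) ?_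
    have := ZMod.le_card_sum_of_sum_card hp (range k) (A := A) fun r hr => by
      obtain ⟨i, hi⟩ := hsurj r (mem_range.1 hr)
      exact ⟨x i, mem_image_of_mem x (by simpa using hi)⟩
    rw [hAcard, card_range] at this
    omega
  have hmem : ∑ i, x i ∈ ∑ r ∈ range k, A r := by rw [hfull]; exact mem_univ _
  rw [← mem_coe, coe_sum] at hmem
  obtain ⟨g, hg, hgs⟩ := (Set.mem_finsetSum _ _ _).1 hmem
  have hex : ∀ r ∈ range k, ∃ i, c i = r ∧ x i = g r := by
    intro r hr
    simpa [hA] using hg hr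
  choose! f hfc hfx using hex
  have hfinj : Set.InjOn f (range k) := fun r hr s hs h => by
    rw [← hfc r hr, ← hfc s hs, h]
  refine isErdosZ_of_sum_eq (J := (range k).image f) ?_ ?_
  · rw [card_image_of_injOn hfinj, card_range]
  · rw [sum_image hfinj, ← hgs]
    exact sum_congr rfl hfx

/-! ### Lower bounds for the restricted Erdős constants -/

/-- Positions with the same value lie in one block of `k` consecutive positions, so they are told
apart by their residues modulo `k`. -/
theorem isRestricted_natCast {n m k : ℕ} (hk : 0 < k) {y : Fin m → ℕ} (hy : ∀ i, y i < n)
    (hdiv : ∀ i j, y i = y j → (i : ℕ) / k = j / k) :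
    IsRestricted k fun i => (y i : ZMod n) := by
  intro a
  rw [← card_range k]
  refine card_le_card_of_injOn (fun i => (i : ℕ) % k) (fun i _ => by
    simpa using Nat.mod_lt _ hk) fun i hi j hj h => ?_
  simp only [coe_filter, mem_univ, true_and, Set.mem_ofPred_eq] at hi hj
  have h1 : y i = y j := by
    have := (ZMod.natCast_eq_natCast_iff' _ _ _).1 (hi.trans hj.symm)
    rwa [Nat.mod_eq_of_lt (hy i), Nat.mod_eq_of_lt (hy j)] at this
  have h2 := hdiv i j h1
  ext
  rw [← Nat.div_add_mod (i : ℕ) k, ← Nat.div_add_mod (j : ℕ) k, h2]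
  simp only at h
  rw [h]

/-- The sequence `⌊i / k⌋`, `i < n + k - 1`, with its last `j` terms raised by one, stays
`k`-restricted, and `j` can be chosen so that its sum is `-1` modulo `n`. Its terms are so small
that no `k - 1` of them have this sum. -/
theorem le_restrictedErdosConst {n k : ℕ} (hk : 2 ≤ k)
    (hn : (k - 1) * ((n + k - 2) / k + 1) + 2 ≤ n) : n + k ≤ restrictedErdosConst k n := by
  have : NeZero n := ⟨by omega⟩
  set L := (n + k - 2) / k + 1 with hL
  set S := ∑ i : Fin (n + k - 1), (i : ℕ) / k with hS
  set j := (-1 - (S : ZMod n)).val with hj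
  have hjn : j < n := ZMod.val_lt _
  set y : Fin (n + k - 1) → ℕ := fun i => i / k + if n + k - 1 - j ≤ i then 1 else 0 with hy
  have hyL : ∀ i, y i ≤ L := by
    intro i
    have h1 : (i : ℕ) / k ≤ (n + k - 2) / k := Nat.div_le_div_right (by omega)
    simp only [hy]
    split_ifs <;> omega
  have hLn : L + 2 ≤ n := by
    have : 1 * L ≤ (k - 1) * L := Nat.mul_le_mul_right L (by omega)
    omega
  have hrest : IsRestricted k fun i => (y i : ZMod n) := by
    refine isRestricted_natCast (by omega) (fun i => by have := hyL i; omega) ?_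
    -- The raised terms are the last ones, so `y` strictly increases from one block of `k` positions
    -- to any later one.
    have hlt : ∀ i i' : Fin (n + k - 1), y i = y i' → ¬ (i : ℕ) / k < i' / k := by
      intro i i' h hlt
      have hii : (i : ℕ) < i' := by
        by_contra! hle
        exact absurd (Nat.div_le_div_right (c := k) hle) (by omega)
      simp only [hy] at h
      split_ifs at h <;> omega
    intro i i' h
    have := hlt i i' h
    have := hlt i' i h.symm
    omega
  have hsum : ∑ i, (y i : ZMod n) = -1 := by
    have h1 : ∑ i, y i = S + j := by
      simp only [hy]
      rw [sum_add_distrib, ← hS, ← card_filter]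
      congr 1
      rw [card_filter, Fin.sum_univ_eq_sum_range (fun i => if n + k - 1 - j ≤ i then 1 else 0),
        ← card_filter]
      have h2 : (range (n + k - 1)).filter (fun i => n + k - 1 - j ≤ i) =
          Ico (n + k - 1 - j) (n + k - 1) := by
        ext i; simp only [mem_filter, mem_range, mem_Ico]; omega
      rw [h2, Nat.card_Ico]
      omega
    rw [← Nat.cast_sum, h1, Nat.cast_add, hj, ZMod.natCast_zmod_val]
    ring
  have hE : ¬ IsErdosZ fun i => (y i : ZMod n) := by
    rintro ⟨I, hI, h0⟩
    have h1 := sum_add_sum_compl I fun i => (y i : ZMod n)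
    rw [h0, hsum, zero_add, ← Nat.cast_sum] at h1
    have h2 : ∑ i ∈ Iᶜ, y i ≤ (k - 1) * L := by
      have h3 : Iᶜ.card = k - 1 := by rw [card_compl, hI, Fintype.card_fin]; omega
      rw [← h3, ← smul_eq_mul]
      exact sum_le_card_nsmul _ _ _ fun i _ => hyL i
    have h4 : ((∑ i ∈ Iᶜ, y i + 1 : ℕ) : ZMod n) = 0 := by
      rw [Nat.cast_add, h1]; simp
    have := Nat.le_of_dvd (by omega) ((ZMod.natCast_eq_zero_iff _ _).1 h4)
    omega
  have := lt_restrictedErdosConst hrest hE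
  omega

/-- The sequence `0, 0, 1, 1` works: no term equals the total `2`. -/
theorem five_le_restrictedErdosConst_two_three : 5 ≤ restrictedErdosConst 2 3 := by
  have h1 : IsRestricted 2 (![0, 0, 1, 1] : Fin 4 → ZMod 3) := by
    unfold IsRestricted; decide
  have h2 : ¬ IsErdosZ (![0, 0, 1, 1] : Fin 4 → ZMod 3) := by
    unfold IsErdosZ; decide
  exact lt_restrictedErdosConst h1 h2

/-! ### The restricted Davenport constants -/

/-- The sequence `1 + ⌊i / k⌋`, `i < m`, has all its terms and its total sum in `[1, n - 1]` if
`m` is at most `√(n k) / 2`. -/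
theorem exists_isRestricted_not_isDavenportZ {n m k : ℕ} (hk : 2 ≤ k) (hkn : k ≤ n)
    (hm : 4 * m ^ 2 ≤ n * k) :
    ∃ y : Fin m → ZMod n, IsRestricted k y ∧ ¬ IsDavenportZ y := by
  have hmn : 2 * m ≤ n := by
    have : (2 * m) ^ 2 ≤ n ^ 2 := by nlinarith
    exact (Nat.pow_le_pow_iff_left two_ne_zero).1 this
  have hmul : m * (m / k) * 4 ≤ n := by
    have h1 : m / k * k ≤ m := Nat.div_mul_le_self _ _
    have h2 : m * (m / k) * 4 * k ≤ n * k := by nlinarith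
    exact Nat.le_of_mul_le_mul_right h2 (by omega)
  set y : Fin m → ℕ := fun i => i / k + 1 with hy
  have hyle : ∀ i, y i ≤ m / k + 1 := fun i =>
    Nat.succ_le_succ (Nat.div_le_div_right i.2.le)
  have hle : ∀ I : Finset (Fin m), ∑ i ∈ I, y i < n := by
    intro I
    have h1 : ∑ i ∈ I, y i ≤ m * (m / k + 1) := by
      refine (sum_le_card_nsmul _ _ _ fun i _ => hyle i).trans ?_
      rw [smul_eq_mul]
      exact Nat.mul_le_mul_right _ ((card_le_univ I).trans_eq (Fintype.card_fin m))
    rw [mul_add, mul_one] at h1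
    omega
  refine ⟨fun i => (y i : ZMod n), isRestricted_natCast (by omega) (fun i => ?_) ?_, ?_⟩
  · simpa using hle {i}
  · intro i j h; simpa [hy] using h
  · rintro ⟨I, ⟨i, hi⟩, h0⟩
    rw [← Nat.cast_sum, ZMod.natCast_eq_zero_iff] at h0
    have h1 : y i ≤ ∑ i ∈ I, y i := single_le_sum (fun _ _ => Nat.zero_le _) hi
    have h2 : 1 ≤ y i := Nat.succ_pos _
    have := Nat.le_of_dvd (by omega) h0
    have := hle I
    omega

theorem two_le_sqrt_mul {n k : ℕ} (hk : 2 ≤ k) (hkn : k ≤ n) : 2 ≤ Nat.sqrt (n * k) := by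
  rw [Nat.le_sqrt]
  exact Nat.mul_le_mul (hk.trans hkn) hk

theorem IsRestricted.isDavenportZ_of_le {n m k : ℕ} (hk : 0 < k) (hn : 0 < n)
    {x : Fin m → ZMod n} (hx : IsRestricted k x) (hm : 161 * √((n : ℝ) * k) ≤ m) :
    IsDavenportZ x := by
  have : NeZero n := ⟨hn.ne'⟩
  by_contra hD
  have h := card_sq_le_of_zeroSumFree (x := x) (I := univ) n (ZMod.card n) hx
    fun J _ hJ h0 => hD ⟨J, hJ, h0⟩
  rw [card_univ, Fintype.card_fin] at h
  have h' : (m : ℝ) ^ 2 ≤ 25600 * k * n := by exact_mod_cast h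
  have hpos : 0 < (n : ℝ) * k := by positivity
  have hs := Real.sq_sqrt hpos.le
  have hs0 := Real.sqrt_pos.2 hpos
  nlinarith

end

theorem theorem1 :
    -- (1) the case `k = 2`, for all `n ≥ 1` other than `1, 2, 4`; the upper bound for all `n ≥ 1`
    ((∀ n : ℕ, 1 ≤ n → restrictedErdosConst 2 n ≤ n + 2) ∧
      (∀ n : ℕ, 1 ≤ n → n ≠ 1 → n ≠ 2 → n ≠ 4 → restrictedErdosConst 2 n = n + 2)) ∧
    -- (2) prime modulus
    ((∀ k : ℕ, 2 ≤ k → ∀ p : ℕ, p.Prime → restrictedErdosConst k p ≤ p + k) ∧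
      (∀ k : ℕ, 2 ≤ k → ∃ p₀ : ℕ, ∀ p : ℕ, p.Prime → p₀ ≤ p →
        p + k ≤ restrictedErdosConst k p)) ∧
    -- (3) zero-sum subsequences of arbitrary positive length, with absolute constants
    (∃ c C : ℝ, 0 < c ∧ 0 < C ∧
      (∀ k n : ℕ, 2 ≤ k → 1 ≤ n →
        (∀ m : ℕ, C * √((n : ℝ) * k) ≤ m →
          ∀ x : Fin m → ZMod n, IsRestricted k x → IsDavenportZ x) ∧
        (restrictedDavenportConst k n : ℝ) ≤ C * √((n : ℝ) * k)) ∧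
      (∀ k n : ℕ, 2 ≤ k → k ≤ n →
        (∃ m : ℕ, c * √((n : ℝ) * k) ≤ m ∧
          ∃ y : Fin m → ZMod n, IsRestricted k y ∧ ¬ IsDavenportZ y) ∧
        c * √((n : ℝ) * k) ≤ restrictedDavenportConst k n)) := by
  refine ⟨⟨fun n hn => ?_, fun n hn h1 h2 h4 => ?_⟩, ⟨fun k hk p hp => ?_, fun k hk => ?_⟩, ?_⟩
  · have : NeZero n := ⟨by omega⟩
    exact Nat.sInf_le fun x hx => hx.isErdosZ_of_two
  · have : NeZero n := ⟨by omega⟩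
    refine le_antisymm (Nat.sInf_le fun x hx => hx.isErdosZ_of_two) ?_
    -- For `n = 3` the terms of the general construction are too large.
    by_cases h3 : n = 3
    · subst h3
      exact five_le_restrictedErdosConst_two_three
    · exact le_restrictedErdosConst le_rfl (by omega)
  · exact Nat.sInf_le fun x hx => hx.isErdosZ_of_prime hp (by omega)
  · refine ⟨2 * k ^ 2, fun p _ hpk => le_restrictedErdosConst hk ?_⟩
    have h1 : k * ((p + k - 2) / k) ≤ p + k - 2 := Nat.mul_div_le _ _
    obtain ⟨l, rfl⟩ : ∃ l, k = l + 2 := ⟨k - 2, by omega⟩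
    have h2 : p + (l + 2) - 2 = p + l := by omega
    rw [h2] at h1 ⊢
    have h3 : l + 2 - 1 = l + 1 := by omega
    rw [h3]
    refine Nat.le_of_mul_le_mul_left ?_ (show 0 < l + 2 by omega)
    have h4 := Nat.mul_le_mul_left (l + 1) h1
    nlinarith
  · refine ⟨1 / 4, 162, by norm_num, by norm_num, fun k n hk hn => ?_, fun k n hk hkn => ?_⟩
    · have hnk : (1 : ℝ) ≤ √((n : ℝ) * k) := by
        rw [Real.one_le_sqrt]
        exact_mod_cast Nat.mul_le_mul hn (show 1 ≤ k by omega)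
      refine ⟨fun m hm x hx => hx.isDavenportZ_of_le (by omega) hn (by linarith), ?_⟩
      have h1 : restrictedDavenportConst k n ≤ ⌈161 * √((n : ℝ) * k)⌉₊ :=
        Nat.sInf_le fun x hx => hx.isDavenportZ_of_le (by omega) hn (Nat.le_ceil _)
      have h2 : (restrictedDavenportConst k n : ℝ) ≤ ⌈161 * √((n : ℝ) * k)⌉₊ := by
        exact_mod_cast h1
      have h3 := Nat.ceil_lt_add_one (a := 161 * √((n : ℝ) * k)) (by positivity)
      linarith
    · have : NeZero n := ⟨by omega⟩
      have hs := two_le_sqrt_mul hk hkn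
      set m := Nat.sqrt (n * k) / 2 with hm
      have hm4 : 4 * m ^ 2 ≤ n * k := by
        have h1 := Nat.sqrt_le' (n * k)
        have h2 : 2 * m ≤ Nat.sqrt (n * k) := Nat.mul_div_le _ _
        nlinarith
      have hcm : 1 / 4 * √((n : ℝ) * k) ≤ m := by
        have h1 : √((n : ℝ) * k) ≤ Nat.sqrt (n * k) + 1 := by
          have := Real.real_sqrt_le_nat_sqrt_succ (a := n * k)
          push_cast at this
          exact this
        have h2 : (Nat.sqrt (n * k) : ℝ) + 1 ≤ 4 * m := by
          exact_mod_cast (show Nat.sqrt (n * k) + 1 ≤ 4 * m by omega)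
        linarith
      obtain ⟨y, hy, hD⟩ := exists_isRestricted_not_isDavenportZ hk hkn hm4
      refine ⟨⟨m, hcm, y, hy, hD⟩, hcm.trans ?_⟩
      exact_mod_cast (lt_restrictedDavenportConst hy hD).le
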